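/- Let $d\ge 1$. A $d\times d$ matrix $M$ with rows and columns indexed by $\mathbb{Z}/d\mathbb{Z}$ is circulant if $M_{j+l,k}=M_{j,k-l}$ for all $j,k,l$. A real $d\times d$ matrix $B$ is unistochastic if $B_{ij}=|U_{ij}|^2$ for all $i,j$ for some unitary matrix $U$, and a circulant unistochastic matrix $B$ is doubly circulant if $U$ can be chosen circulant. Let $H_d\subset\mathbb{C}$ be the closed region enclosed by the unit $d$-hypocycloid $\gamma_d(\theta)=x(\theta)+i\,y(\theta)$, $\theta\in\mathbb{R}$, where $$x(\theta)=\frac{d-1}{d}\cos\theta+\frac1d\cos((d-1)\theta),\qquad y(\theta)=\frac{d-1}{d}\sin\theta-\frac1d\sin((d-1)\theta).$$ Explicitly, for $d\ge2$ it is the region star-shaped about the origin $H_d=\{t\,\gamma_d(\theta): t\in[0,1],\ \theta\in\mathbb{R}\}$ (so $H_2=[-1,1]$), and $H_1=\{1\}$. **Theorem.** Every (complex) eigenvalue of a $d\times d$ doubly circulant unistochastic matrix lies in $H_d$. -/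

import Mathlib

/-- A `d × d` matrix is circulant if `B (j + l) k = B j (k - l)` for all indices, where the
addition and subtraction in `Fin d` are modulo `d`. -/
def IsCirculantMatrix {d : ℕ} {R : Type*} (B : Matrix (Fin d) (Fin d) R) : Prop :=
  ∀ j k l : Fin d, B (j + l) k = B j (k - l)

/-- A real matrix is unistochastic if its entries are the squared moduli of the entries of a
unitary matrix. -/
def IsUnistochastic {d : ℕ} (B : Matrix (Fin d) (Fin d) ℝ) : Prop :=
  ∃ U ∈ Matrix.unitaryGroup (Fin d) ℂ, ∀ i j, B i j = ‖U i j‖ ^ 2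

/-- A circulant unistochastic matrix is doubly circulant if the underlying unitary matrix
can be chosen circulant. -/
def IsDoublyCirculantUnistochastic {d : ℕ} (B : Matrix (Fin d) (Fin d) ℝ) : Prop :=
  IsCirculantMatrix B ∧ IsUnistochastic B ∧
    ∃ U ∈ Matrix.unitaryGroup (Fin d) ℂ, IsCirculantMatrix U ∧ ∀ i j, B i j = ‖U i j‖ ^ 2

/-- The point with parameter `θ` on the unit `d`-hypocycloid curve in the complex plane. -/
noncomputable def hypocycloidPoint (d : ℕ) (θ : ℝ) : ℂ where
  re := ((d : ℝ) - 1) / d * Real.cos θ + 1 / d * Real.cos (((d : ℝ) - 1) * θ)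
  im := ((d : ℝ) - 1) / d * Real.sin θ - 1 / d * Real.sin (((d : ℝ) - 1) * θ)

/-- The (closed) region `H_d` bounded by the unit `d`-hypocycloid. For `d ≥ 2` it is
star-shaped about the origin, and so it is the union of the segments that join the origin to the
points of the curve (for `d = 2` it degenerates to the segment from `-1` to `1`).
For `d = 1` the curve is constant and the region is the single point `1`. -/
noncomputable def hypocycloidRegion (d : ℕ) : Set ℂ :=
  if d = 1 then {1} else ⋃ θ : ℝ, segment ℝ 0 (hypocycloidPoint d θ)

/-! Let `u` be row 0 of the circulant unitary. Its Fourier transform û is unimodular, and each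
eigenvalue of `B` is a Fourier coefficient of |u|², hence the average over characters ψ of
û(ψχ)·conj û(ψ). These are d unit numbers whose product is 1, since ψ ↦ ψχ permutes the characters.
It remains to locate the averages of such configurations. The sums form a compact set K. On the ray
through a nonzero sum, the last point of K is not interior. A configuration with three distinct
values, or with two distinct values each taken twice, has its sum in the interior of K. So at the
last point all entries but one equal some a, the other being a^{-(d-1)}: the average is a
hypocycloid point, and the original average lies on the segment from 0 to it. -/

open Filter Topology ComplexConjugate

/-- The configurations of unit complex numbers, indexed by `ι`, whose product is `1`. -/
def unitConfigurations (ι : Type*) [Fintype ι] : Set (ι → ℂ) :=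
  {μ | (∀ i, ‖μ i‖ = 1) ∧ ∏ i, μ i = 1}

theorem isCompact_unitConfigurations (ι : Type*) [Fintype ι] :
    IsCompact (unitConfigurations ι) := by
  have hpi : IsCompact (Set.univ.pi fun _ : ι => Metric.sphere (0 : ℂ) 1) :=
    isCompact_univ_pi fun _ => isCompact_sphere _ _
  have hclosed : IsClosed {μ : ι → ℂ | ∏ i, μ i = 1} :=
    isClosed_eq (by fun_prop) continuous_const
  convert hpi.inter_right hclosed using 1
  ext μ
  simp [unitConfigurations]

/-- Interiority is local: perturb only the coordinates in `s`, keeping their product, and leave the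
others fixed. -/
theorem sum_image_mem_nhds_of_local {ι : Type*} [Fintype ι] [DecidableEq ι] {μ : ι → ℂ}
    (hμ : μ ∈ unitConfigurations ι) (s : Finset ι)
    (h : ∀ᶠ T in 𝓝 (∑ i ∈ s, μ i), ∃ ν : ι → ℂ, (∀ i ∈ s, ‖ν i‖ = 1) ∧
      ∏ i ∈ s, ν i = ∏ i ∈ s, μ i ∧ ∑ i ∈ s, ν i = T) :
    (fun μ : ι → ℂ => ∑ i, μ i) '' unitConfigurations ι ∈ 𝓝 (∑ i, μ i) := by
  have hlim : Tendsto (fun T => T - ∑ i ∈ sᶜ, μ i) (𝓝 (∑ i, μ i)) (𝓝 (∑ i ∈ s, μ i)) := by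
    have hc : Continuous fun T : ℂ => T - ∑ i ∈ sᶜ, μ i := by fun_prop
    have := hc.tendsto (∑ i, μ i)
    rwa [← Finset.sum_add_sum_compl s μ, add_sub_cancel_right, Finset.sum_add_sum_compl] at this
  filter_upwards [hlim.eventually h] with T hT
  obtain ⟨ν, hν, hprod, hsum⟩ := hT
  refine ⟨s.piecewise ν μ, ⟨fun i => ?_, ?_⟩, ?_⟩
  · by_cases hi : i ∈ s
    · simp [hi, hν i hi]
    · simp [hi, hμ.1 i]
  · rw [Finset.prod_piecewise, Finset.univ_inter, hprod, ← hμ.2, ← Finset.compl_eq_univ_sdiff,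
      Finset.prod_mul_prod_compl]
  · change ∑ i, s.piecewise ν μ i = T
    rw [Finset.sum_piecewise, Finset.univ_inter, hsum, ← Finset.compl_eq_univ_sdiff,
      sub_add_cancel]

theorem conj_eq_inv_of_norm_eq_one {a : ℂ} (ha : ‖a‖ = 1) : conj a = a⁻¹ :=
  (Complex.inv_eq_conj ha).symm

/-! ### Perturbing three distinct values -/

/-- Three distinct points of the unit circle are not collinear. -/
theorem im_conj_mul_ne_zero_of_unit {a b c : ℂ} (ha : ‖a‖ = 1) (hb : ‖b‖ = 1) (hc : ‖c‖ = 1)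
    (hab : a ≠ b) (hac : a ≠ c) (hbc : b ≠ c) : (conj (a - c) * (b - c)).im ≠ 0 := by
  intro h
  have h' := Complex.conj_eq_iff_im.2 h
  have ha0 : a ≠ 0 := norm_ne_zero_iff.1 (by simp [ha])
  have hb0 : b ≠ 0 := norm_ne_zero_iff.1 (by simp [hb])
  have hc0 : c ≠ 0 := norm_ne_zero_iff.1 (by simp [hc])
  -- With conjugates replaced by inverses, reality becomes a polynomial identity: the product of the
  -- three differences vanishes.
  simp only [map_mul, map_sub, map_inv₀, inv_inv, conj_eq_inv_of_norm_eq_one ha,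
    conj_eq_inv_of_norm_eq_one hb, conj_eq_inv_of_norm_eq_one hc] at h'
  field_simp at h'
  have : (a - b) * (a - c) * (b - c) = 0 := by linear_combination -h'
  simp [sub_eq_zero, hab, hac, hbc] at this

theorem exists_real_combination {P Q : ℂ} (h : (conj P * Q).im ≠ 0) (v : ℂ) :
    ∃ x y : ℝ, v = x * P + y * Q := by
  have hd : P.re * Q.im - P.im * Q.re ≠ 0 := by
    simp only [Complex.mul_im, Complex.conj_re, Complex.conj_im] at h
    intro h0
    apply h
    linarith
  refine ⟨(v.re * Q.im - v.im * Q.re) / (P.re * Q.im - P.im * Q.re),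
    (P.re * v.im - P.im * v.re) / (P.re * Q.im - P.im * Q.re), ?_⟩
  apply Complex.ext
  · rw [Complex.add_re, Complex.re_ofReal_mul, Complex.re_ofReal_mul, div_mul_eq_mul_div,
      div_mul_eq_mul_div, ← add_div, eq_div_iff hd]
    ring
  · rw [Complex.add_im, Complex.im_ofReal_mul, Complex.im_ofReal_mul, div_mul_eq_mul_div,
      div_mul_eq_mul_div, ← add_div, eq_div_iff hd]
    ring

/-- Rotating by angles x, y, -x-y preserves the product. The derivative of the sum at 0 is i(x(a-c)
+ y(b-c)), onto because the three points are not collinear; a map with surjective strict derivative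
is locally open. -/
theorem eventually_exists_unit_triple {a b c : ℂ} (ha : ‖a‖ = 1) (hb : ‖b‖ = 1) (hc : ‖c‖ = 1)
    (hab : a ≠ b) (hac : a ≠ c) (hbc : b ≠ c) :
    ∀ᶠ T in 𝓝 (a + b + c), ∃ a' b' c' : ℂ, ‖a'‖ = 1 ∧ ‖b'‖ = 1 ∧ ‖c'‖ = 1 ∧
      a' * b' * c' = a * b * c ∧ a' + b' + c' = T := by
  let e : ℝ →L[ℝ] ℂ := Complex.ofRealCLM
  let X : ℝ × ℝ →L[ℝ] ℂ := e.comp (ContinuousLinearMap.fst ℝ ℝ ℝ)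
  let Y : ℝ × ℝ →L[ℝ] ℂ := e.comp (ContinuousLinearMap.snd ℝ ℝ ℝ)
  let F : ℝ × ℝ → ℂ := fun p => a * Complex.exp (X p * Complex.I) +
    b * Complex.exp (Y p * Complex.I) + c * Complex.exp ((-X p - Y p) * Complex.I)
  have hF := (((((X.hasStrictFDerivAt (x := 0)).mul_const Complex.I).cexp.const_mul a).add
    (((Y.hasStrictFDerivAt (x := 0)).mul_const Complex.I).cexp.const_mul b)).add
    ((((X.hasStrictFDerivAt (x := 0)).neg.sub
      (Y.hasStrictFDerivAt (x := 0))).mul_const Complex.I).cexp.const_mul c))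
  have hsurj := hF.map_nhds_eq_of_surj (by
    rw [LinearMap.range_eq_top]
    intro w
    obtain ⟨x, y, hxy⟩ := exists_real_combination
      (im_conj_mul_ne_zero_of_unit ha hb hc hab hac hbc) (-Complex.I * w)
    refine ⟨(x, y), ?_⟩
    simp [X, Y, e]
    linear_combination -Complex.I * hxy - w * Complex.I_sq)
  have h0 : F 0 = a + b + c := by simp [F]
  have hmap : map F (𝓝 0) = 𝓝 (a + b + c) := by rw [← h0]; exact hsurj
  rw [← hmap, eventually_map]
  refine Eventually.of_forall fun p => ⟨_, _, _, ?_, ?_, ?_, ?_, rfl⟩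
  · simp only [X, e, ContinuousLinearMap.comp_apply, Complex.ofRealCLM_apply, norm_mul, ha,
      Complex.norm_exp_ofReal_mul_I, mul_one]
  · simp only [Y, e, ContinuousLinearMap.comp_apply, Complex.ofRealCLM_apply, norm_mul, hb,
      Complex.norm_exp_ofReal_mul_I, mul_one]
  · simp only [X, Y, e, ContinuousLinearMap.comp_apply, Complex.ofRealCLM_apply, norm_mul, hc,
      ← Complex.ofReal_neg, ← Complex.ofReal_sub, Complex.norm_exp_ofReal_mul_I, mul_one]
  · have : Complex.exp (X p * Complex.I) * Complex.exp (Y p * Complex.I) *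
        Complex.exp ((-X p - Y p) * Complex.I) = 1 := by
      rw [← Complex.exp_add, ← Complex.exp_add, ← Complex.exp_zero]
      congr 1
      ring
    linear_combination a * b * c * this

/-! ### Perturbing two repeated values -/

theorem exists_unit_pair_of_abs_le_two {p : ℝ} (hp : |p| ≤ 2) :
    ∃ u v : ℂ, ‖u‖ = 1 ∧ ‖v‖ = 1 ∧ u * v = 1 ∧ u + v = p := by
  obtain ⟨h1, h2⟩ := abs_le.1 hp
  set ε := Real.arccos (p / 2)
  have hcos : Real.cos ε = p / 2 := Real.cos_arccos (by linarith) (by linarith)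
  refine ⟨Complex.exp (ε * Complex.I), Complex.exp (-(ε * Complex.I)),
    Complex.norm_exp_ofReal_mul_I ε, ?_, ?_, ?_⟩
  · rw [← neg_mul, ← Complex.ofReal_neg, Complex.norm_exp_ofReal_mul_I]
  · rw [← Complex.exp_add, add_neg_cancel, Complex.exp_zero]
  · have := Complex.two_cos (ε : ℂ)
    rw [neg_mul, ← Complex.ofReal_cos, hcos] at this
    rw [← this]
    push_cast
    ring

/-- The points `p e^{iy} + q e^{-iy}` with `|p|, |q| ≤ 2` fill a neighbourhood of `4 cos φ`. -/
theorem eventually_exists_rhombus {φ : ℝ} (h0 : 0 < φ) (hπ : φ < Real.pi) :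
    ∀ᶠ T in 𝓝 ((4 * Real.cos φ : ℝ) : ℂ), ∃ y p q : ℝ, |p| ≤ 2 ∧ |q| ≤ 2 ∧
      p * Complex.exp (y * Complex.I) + q * Complex.exp (-(y * Complex.I)) = T := by
  -- Any y₁ in (0, φ) and y₂ in (φ, π) would serve; midpoints are taken.
  set y₁ := φ / 2 with hy₁
  set y₂ := (φ + Real.pi) / 2 with hy₂
  have hs₁ : 0 < Real.sin y₁ := Real.sin_pos_of_pos_of_lt_pi (by linarith) (by linarith)
  have hs₂ : 0 < Real.sin y₂ := Real.sin_pos_of_pos_of_lt_pi (by linarith) (by linarith)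
  have hc₁ : Real.cos φ < Real.cos y₁ :=
    Real.cos_lt_cos_of_nonneg_of_le_pi (by linarith) (by linarith) (by linarith)
  have hc₂ : Real.cos y₂ < Real.cos φ :=
    Real.cos_lt_cos_of_nonneg_of_le_pi (by linarith) (by linarith) (by linarith)
  -- The sum is (p+q) cos y + i(p-q) sin y. Matching Im T forces p-q = t := Im T / sin y, and 4-|t|
  -- is then the largest admissible p+q. It remains to solve (4-|t|) cos y = Re T for y by the
  -- intermediate value theorem.
  have e₁ : ∀ᶠ T in 𝓝 ((4 * Real.cos φ : ℝ) : ℂ),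
      T.re < (4 - |T.im| / Real.sin y₁) * Real.cos y₁ :=
    Tendsto.eventually_lt (f := fun T : ℂ => T.re) Complex.continuous_re.continuousAt
      (g := fun T : ℂ => (4 - |T.im| / Real.sin y₁) * Real.cos y₁)
      (ContinuousAt.tendsto (by fun_prop)) (by
        simp only [Complex.ofReal_re, Complex.ofReal_im, abs_zero, zero_div, sub_zero]
        linarith)
  have e₂ : ∀ᶠ T in 𝓝 ((4 * Real.cos φ : ℝ) : ℂ),
      (4 - |T.im| / Real.sin y₂) * Real.cos y₂ < T.re :=
    Tendsto.eventually_lt (g := fun T : ℂ => T.re)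
      (f := fun T : ℂ => (4 - |T.im| / Real.sin y₂) * Real.cos y₂)
      (ContinuousAt.tendsto (by fun_prop)) Complex.continuous_re.continuousAt (by
        simp only [Complex.ofReal_re, Complex.ofReal_im, abs_zero, zero_div, sub_zero]
        linarith)
  have e₃ : ∀ᶠ T in 𝓝 ((4 * Real.cos φ : ℝ) : ℂ),
      |T.im| < min (Real.sin y₁) (Real.sin y₂) :=
    Tendsto.eventually_lt (f := fun T : ℂ => |T.im|)
      (ContinuousAt.tendsto (by fun_prop)) tendsto_const_nhds (by simp [hs₁, hs₂])
  filter_upwards [e₁, e₂, e₃] with T h₁ h₂ h₃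
  have hsin : ∀ y ∈ Set.Icc y₁ y₂, |T.im| < Real.sin y := fun y hy =>
    h₃.trans_le (strictConcaveOn_sin_Icc.concaveOn.min_le_of_mem_Icc
      ⟨by linarith, by linarith⟩ ⟨by linarith, by linarith⟩ hy)
  have hcont : ContinuousOn (fun y => (4 - |T.im| / Real.sin y) * Real.cos y)
      (Set.Icc y₁ y₂) := by
    refine ContinuousOn.mul (continuousOn_const.sub (continuousOn_const.div
      Real.continuous_sin.continuousOn fun y hy => ?_)) Real.continuous_cos.continuousOn
    exact ((abs_nonneg _).trans_lt (hsin y hy)).ne'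
  obtain ⟨y, hy, hyT⟩ := intermediate_value_Icc' (by linarith) hcont ⟨h₂.le, h₁.le⟩
  have hpos : 0 < Real.sin y := (abs_nonneg _).trans_lt (hsin y hy)
  have hle : |T.im / Real.sin y| ≤ 1 := by
    rw [abs_div, abs_of_pos hpos, div_le_one hpos]
    exact (hsin y hy).le
  have habs : |T.im| / Real.sin y = |T.im / Real.sin y| := by rw [abs_div, abs_of_pos hpos]
  have him : T.im / Real.sin y * Real.sin y = T.im := div_mul_cancel₀ _ hpos.ne'
  simp only [habs] at hyT
  set t := T.im / Real.sin y
  refine ⟨y, (4 - |t| + t) / 2, (4 - |t| - t) / 2, ?_, ?_, ?_⟩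
  · rw [abs_le]
    constructor <;> linarith [le_abs_self t, neg_abs_le t]
  · rw [abs_le]
    constructor <;> linarith [le_abs_self t, neg_abs_le t]
  · rw [← neg_mul, ← Complex.ofReal_neg]
    apply Complex.ext
    · simp only [Complex.add_re, Complex.re_ofReal_mul, Complex.exp_ofReal_mul_I_re, Real.cos_neg]
      linarith
    · simp only [Complex.add_im, Complex.im_ofReal_mul, Complex.exp_ofReal_mul_I_im, Real.sin_neg]
      linarith

theorem exists_midpoint_angle {a b : ℂ} (ha : ‖a‖ = 1) (hb : ‖b‖ = 1)
    (hlt : b.arg < a.arg) : ∃ (m : ℂ) (φ : ℝ), ‖m‖ = 1 ∧ 0 < φ ∧ φ < Real.pi ∧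
      a = m * Complex.exp (φ * Complex.I) ∧ b = m * Complex.exp (-(φ * Complex.I)) := by
  refine ⟨Complex.exp (((a.arg + b.arg) / 2 : ℝ) * Complex.I), (a.arg - b.arg) / 2,
    Complex.norm_exp_ofReal_mul_I _, by linarith,
    by linarith [Complex.arg_le_pi a, Complex.neg_pi_lt_arg b], ?_, ?_⟩
  · rw [← Complex.exp_add]
    nth_rw 1 [← Complex.norm_mul_exp_arg_mul_I a]
    rw [ha, Complex.ofReal_one, one_mul]
    congr 1
    push_cast
    ring
  · rw [← Complex.exp_add]
    nth_rw 1 [← Complex.norm_mul_exp_arg_mul_I b]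
    rw [hb, Complex.ofReal_one, one_mul]
    congr 1
    push_cast
    ring

/-- Here the first-order variation of the sum has rank one, so the inverse function theorem does not
apply. After rotation by m the values are e^{±iφ}; each pair is replaced by e^{±iy} times a
conjugate unit pair of sum p or q, which reduces the claim to `eventually_exists_rhombus`. -/
theorem eventually_exists_unit_quadruple {a b : ℂ} (ha : ‖a‖ = 1) (hb : ‖b‖ = 1) (hab : a ≠ b) :
    ∀ᶠ T in 𝓝 (a + a + (b + b)), ∃ a₁ a₂ b₁ b₂ : ℂ, ‖a₁‖ = 1 ∧ ‖a₂‖ = 1 ∧ ‖b₁‖ = 1 ∧ ‖b₂‖ = 1 ∧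
      a₁ * a₂ * (b₁ * b₂) = a * a * (b * b) ∧ a₁ + a₂ + (b₁ + b₂) = T := by
  wlog hlt : b.arg < a.arg generalizing a b
  · have hne : a.arg ≠ b.arg := fun h => hab (Complex.ext_norm_arg (ha.trans hb.symm) h)
    have := this hb ha hab.symm (lt_of_le_of_ne (not_lt.1 hlt) hne)
    rw [add_comm (a + a)]
    filter_upwards [this] with T hT
    obtain ⟨a₁, a₂, b₁, b₂, h₁, h₂, h₃, h₄, hp, hs⟩ := hT
    exact ⟨b₁, b₂, a₁, a₂, h₃, h₄, h₁, h₂, by linear_combination hp, by linear_combination hs⟩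
  obtain ⟨m, φ, hm, h0, hπ, rfl, rfl⟩ := exists_midpoint_angle ha hb hlt
  have hm0 : m ≠ 0 := norm_ne_zero_iff.1 (by simp [hm])
  have hlim : Tendsto (fun T => m⁻¹ * T) (𝓝 (m * Complex.exp (φ * Complex.I) +
      m * Complex.exp (φ * Complex.I) + (m * Complex.exp (-(φ * Complex.I)) +
      m * Complex.exp (-(φ * Complex.I))))) (𝓝 ((4 * Real.cos φ : ℝ) : ℂ)) := by
    have hc : Continuous fun T : ℂ => m⁻¹ * T := by fun_prop
    convert hc.tendsto _ using 2
    have := Complex.two_cos (φ : ℂ)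
    rw [neg_mul] at this
    push_cast
    field_simp
    linear_combination 2 * this
  filter_upwards [hlim.eventually (eventually_exists_rhombus h0 hπ)] with T hT
  obtain ⟨y, p, q, hp, hq, hT⟩ := hT
  obtain ⟨u₁, u₂, hu₁, hu₂, hu, hup⟩ := exists_unit_pair_of_abs_le_two hp
  obtain ⟨v₁, v₂, hv₁, hv₂, hv, hvq⟩ := exists_unit_pair_of_abs_le_two hq
  have hnorm : ∀ x : ℝ, ‖Complex.exp (-(x * Complex.I))‖ = 1 := fun x => by
    rw [← neg_mul, ← Complex.ofReal_neg, Complex.norm_exp_ofReal_mul_I]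
  have hexp : ∀ x : ℝ, Complex.exp (x * Complex.I) * Complex.exp (-(x * Complex.I)) = 1 :=
    fun x => by rw [← Complex.exp_add, add_neg_cancel, Complex.exp_zero]
  refine ⟨m * Complex.exp (y * Complex.I) * u₁, m * Complex.exp (y * Complex.I) * u₂,
    m * Complex.exp (-(y * Complex.I)) * v₁, m * Complex.exp (-(y * Complex.I)) * v₂,
    ?_, ?_, ?_, ?_, ?_, ?_⟩
  · simp [hm, Complex.norm_exp_ofReal_mul_I, hu₁]
  · simp [hm, Complex.norm_exp_ofReal_mul_I, hu₂]
  · simp [hm, hnorm, hv₁]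
  · simp [hm, hnorm, hv₂]
  · calc _ = m ^ 4 * (Complex.exp (y * Complex.I) * Complex.exp (-(y * Complex.I))) ^ 2 *
          (u₁ * u₂) * (v₁ * v₂) := by ring
      _ = m ^ 4 * (Complex.exp (φ * Complex.I) * Complex.exp (-(φ * Complex.I))) ^ 2 := by
          rw [hu, hv, hexp, hexp]; ring
      _ = _ := by ring
  · have hT' : T = m * (m⁻¹ * T) := by field_simp
    rw [hT', ← hT, ← hup, ← hvq]
    ring

/-! ### Configurations with non-interior sum -/

theorem sum_image_mem_nhds_of_three_values {ι : Type*} [Fintype ι] {μ : ι → ℂ}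
    (hμ : μ ∈ unitConfigurations ι) {i j k : ι} (hij : μ i ≠ μ j) (hik : μ i ≠ μ k)
    (hjk : μ j ≠ μ k) :
    (fun μ : ι → ℂ => ∑ i, μ i) '' unitConfigurations ι ∈ 𝓝 (∑ i, μ i) := by
  classical
  have nij : i ≠ j := fun h => hij (by rw [h])
  have nik : i ≠ k := fun h => hik (by rw [h])
  have njk : j ≠ k := fun h => hjk (by rw [h])
  have hs : ∀ f : ι → ℂ, ∑ x ∈ ({i, j, k} : Finset ι), f x = f i + f j + f k := fun f => by
    rw [Finset.sum_insert (by simp [nij, nik]), Finset.sum_pair njk, add_assoc]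
  have hp : ∀ f : ι → ℂ, ∏ x ∈ ({i, j, k} : Finset ι), f x = f i * f j * f k := fun f => by
    rw [Finset.prod_insert (by simp [nij, nik]), Finset.prod_pair njk, mul_assoc]
  apply sum_image_mem_nhds_of_local hμ {i, j, k}
  simp only [hs, hp]
  filter_upwards [eventually_exists_unit_triple (hμ.1 i) (hμ.1 j) (hμ.1 k) hij hik hjk] with T hT
  obtain ⟨a, b, c, ha, hb, hc, h₁, h₂⟩ := hT
  refine ⟨fun x => if x = i then a else if x = j then b else c, ?_, ?_, ?_⟩
  · intro x _
    dsimp only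
    split_ifs <;> assumption
  · simpa [nij.symm, nik.symm, njk.symm] using h₁
  · simpa [nij.symm, nik.symm, njk.symm] using h₂

theorem sum_image_mem_nhds_of_two_pairs {ι : Type*} [Fintype ι] {μ : ι → ℂ}
    (hμ : μ ∈ unitConfigurations ι) {i k j l : ι} (nik : i ≠ k) (njl : j ≠ l)
    (hik : μ k = μ i) (hjl : μ l = μ j) (hij : μ i ≠ μ j) :
    (fun μ : ι → ℂ => ∑ i, μ i) '' unitConfigurations ι ∈ 𝓝 (∑ i, μ i) := by
  classical
  have nij : i ≠ j := fun h => hij (by rw [h])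
  have nil : i ≠ l := fun h => hij (by rw [h, hjl])
  have nkj : k ≠ j := fun h => hij (by rw [← hik, h])
  have nkl : k ≠ l := fun h => hij (by rw [← hik, h, hjl])
  have hs : ∀ f : ι → ℂ, ∑ x ∈ ({i, k, j, l} : Finset ι), f x = f i + f k + (f j + f l) :=
    fun f => by
      rw [Finset.sum_insert (by simp [nik, nij, nil]), Finset.sum_insert (by simp [nkj, nkl]),
        Finset.sum_pair njl, add_assoc]
  have hp : ∀ f : ι → ℂ, ∏ x ∈ ({i, k, j, l} : Finset ι), f x = f i * f k * (f j * f l) :=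
    fun f => by
      rw [Finset.prod_insert (by simp [nik, nij, nil]), Finset.prod_insert (by simp [nkj, nkl]),
        Finset.prod_pair njl, mul_assoc]
  apply sum_image_mem_nhds_of_local hμ {i, k, j, l}
  simp only [hs, hp, hik, hjl]
  filter_upwards [eventually_exists_unit_quadruple (hμ.1 i) (hμ.1 j) hij] with T hT
  obtain ⟨a, a', b, b', ha, ha', hb, hb', h₁, h₂⟩ := hT
  refine ⟨fun x => if x = i then a else if x = k then a' else if x = j then b else b', ?_, ?_, ?_⟩
  · intro x _
    dsimp only
    split_ifs <;> assumption
  · simpa [nik.symm, nij.symm, nil.symm, nkj.symm, nkl.symm, njl.symm] using h₁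
  · simpa [nik.symm, nij.symm, nil.symm, nkj.symm, nkl.symm, njl.symm] using h₂

/-- A configuration whose sum is not interior takes one value at all indices but one. -/
theorem exists_forall_ne_eq_of_not_mem_nhds {ι : Type*} [Fintype ι] [Nonempty ι] {μ : ι → ℂ}
    (hμ : μ ∈ unitConfigurations ι)
    (h : (fun μ : ι → ℂ => ∑ i, μ i) '' unitConfigurations ι ∉ 𝓝 (∑ i, μ i)) :
    ∃ (i₀ : ι) (a : ℂ), ‖a‖ = 1 ∧ ∀ i ≠ i₀, μ i = a := by
  by_cases hall : ∃ i j, μ i ≠ μ j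
  · obtain ⟨i, j, hij⟩ := hall
    have htwo : ∀ k, μ k = μ i ∨ μ k = μ j := fun k => by
      by_contra! hk
      exact h (sum_image_mem_nhds_of_three_values hμ hij hk.1.symm hk.2.symm)
    -- Only two values occur. If that of `i` is repeated, that of `j` cannot be, so `j` is the
    -- exception; otherwise `i` is.
    by_cases hk : ∃ k, k ≠ i ∧ μ k = μ i
    · obtain ⟨k, hki, hk⟩ := hk
      refine ⟨j, μ i, hμ.1 i, fun l hl => (htwo l).resolve_right fun hlj => ?_⟩
      exact h (sum_image_mem_nhds_of_two_pairs hμ hki.symm hl.symm hk hlj hij)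
    · push Not at hk
      exact ⟨i, μ j, hμ.1 j, fun l hl => (htwo l).resolve_left (hk l hl)⟩
  · push Not at hall
    obtain ⟨i₀⟩ := ‹Nonempty ι›
    exact ⟨i₀, μ i₀, hμ.1 i₀, fun i _ => hall i i₀⟩

/-! ### Hypocycloid points and the extremal argument -/

theorem hypocycloidPoint_eq (d : ℕ) (θ : ℝ) : hypocycloidPoint d θ =
    (((d : ℂ) - 1) * Complex.exp (θ * Complex.I) +
      Complex.exp (((-(((d : ℝ) - 1) * θ) : ℝ) : ℂ) * Complex.I)) / d := by
  have h : ((d : ℂ) - 1) = (((d : ℝ) - 1 : ℝ) : ℂ) := by push_cast; rfl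
  have h' : (d : ℂ) = ((d : ℝ) : ℂ) := by push_cast; rfl
  rw [h, h']
  apply Complex.ext
  · rw [Complex.div_ofReal_re]
    simp only [hypocycloidPoint, Complex.add_re, Complex.re_ofReal_mul,
      Complex.exp_ofReal_mul_I_re, Real.cos_neg]
    ring
  · rw [Complex.div_ofReal_im]
    simp only [hypocycloidPoint, Complex.add_im, Complex.im_ofReal_mul,
      Complex.exp_ofReal_mul_I_im, Real.sin_neg]
    ring

/-- The product condition forces the exceptional entry to be a^{-(d-1)}; take θ = arg a. -/
theorem exists_sum_eq_hypocycloidPoint {ι : Type*} [Fintype ι] {μ : ι → ℂ}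
    (hμ : μ ∈ unitConfigurations ι) {i₀ : ι} {a : ℂ} (ha : ‖a‖ = 1) (h : ∀ i ≠ i₀, μ i = a) :
    ∃ θ : ℝ, ∑ i, μ i = Fintype.card ι * hypocycloidPoint (Fintype.card ι) θ := by
  classical
  have hcard : 0 < Fintype.card ι := Fintype.card_pos_iff.2 ⟨i₀⟩
  obtain ⟨n, hn⟩ : ∃ n, Fintype.card ι = n + 1 := ⟨_, (Nat.succ_pred_eq_of_pos hcard).symm⟩
  have hc : (Finset.univ.erase i₀).card = n := by simp [hn]
  have hexp : Complex.exp (a.arg * Complex.I) = a := by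
    simpa [ha] using Complex.norm_mul_exp_arg_mul_I a
  have hprod : μ i₀ * a ^ n = 1 := by
    rw [← hμ.2, ← Finset.mul_prod_erase _ _ (Finset.mem_univ i₀),
      Finset.prod_congr rfl fun i hi => h i (Finset.ne_of_mem_erase hi), Finset.prod_const, hc]
  have hsum : ∑ i, μ i = μ i₀ + n * a := by
    rw [← Finset.add_sum_erase _ _ (Finset.mem_univ i₀),
      Finset.sum_congr rfl fun i hi => h i (Finset.ne_of_mem_erase hi), Finset.sum_const, hc,
      nsmul_eq_mul]
  have hlast : Complex.exp (((-((n : ℝ) * a.arg) : ℝ) : ℂ) * Complex.I) = μ i₀ := by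
    have hpow : Complex.exp (((-((n : ℝ) * a.arg) : ℝ) : ℂ) * Complex.I) * a ^ n = 1 := by
      nth_rw 2 [← hexp]
      rw [← Complex.exp_nat_mul, ← Complex.exp_add, ← Complex.exp_zero]
      congr 1
      push_cast
      ring
    have ha0 : a ≠ 0 := norm_ne_zero_iff.1 (by simp [ha])
    exact mul_right_cancel₀ (pow_ne_zero n ha0) (hpow.trans hprod.symm)
  refine ⟨a.arg, ?_⟩
  have hd : (Fintype.card ι : ℂ) ≠ 0 := by exact_mod_cast hcard.ne'
  rw [hypocycloidPoint_eq, mul_div_cancel₀ _ hd, hexp, hsum]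
  have h1 : ((Fintype.card ι : ℝ) - 1) = n := by rw [hn]; push_cast; ring
  have h2 : ((Fintype.card ι : ℂ) - 1) = n := by rw [hn]; push_cast; ring
  rw [h1, h2, hlast]
  ring

/-- The last point of a compact set on a ray is not interior. -/
theorem exists_last_point_on_ray {K : Set ℂ} (hK : IsCompact K) {z : ℂ} (hz : z ∈ K)
    (hz0 : z ≠ 0) : ∃ s : ℝ, 1 ≤ s ∧ (s : ℂ) * z ∈ K ∧ K ∉ 𝓝 ((s : ℂ) * z) := by
  have hcont : Continuous fun s : ℝ => (s : ℂ) * z := by fun_prop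
  have hclosed : IsClosed ((fun s : ℝ => (s : ℂ) * z) ⁻¹' K) := hK.isClosed.preimage hcont
  obtain ⟨C, hC⟩ := hK.isBounded.exists_norm_le
  have hbdd : BddAbove ((fun s : ℝ => (s : ℂ) * z) ⁻¹' K) := by
    refine ⟨C / ‖z‖, fun s hs => ?_⟩
    have := hC _ hs
    rw [norm_mul, Complex.norm_real] at this
    rw [le_div_iff₀ (norm_pos_iff.2 hz0)]
    exact (mul_le_mul_of_nonneg_right (le_abs_self s) (norm_nonneg z)).trans this
  have h1 : (1 : ℝ) ∈ (fun s : ℝ => (s : ℂ) * z) ⁻¹' K := by simpa using hz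
  refine ⟨_, le_csSup hbdd h1, hclosed.csSup_mem ⟨1, h1⟩ hbdd, fun hnhds => ?_⟩
  -- If K were a neighbourhood of the last point, it would contain points of the ray slightly beyond
  -- the supremum.
  have hev := hcont.continuousAt.eventually_mem hnhds
  obtain ⟨t, ht, htK⟩ := ((hev.filter_mono nhdsWithin_le_nhds).and
    (self_mem_nhdsWithin (s := Set.Ioi (sSup ((fun s : ℝ => (s : ℂ) * z) ⁻¹' K))))).exists
  exact absurd (le_csSup hbdd ht) (not_le.2 htK)

theorem sum_div_card_mem_hypocycloidRegion {ι : Type*} [Fintype ι] [Nonempty ι] {μ : ι → ℂ}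
    (hμ : μ ∈ unitConfigurations ι) :
    (∑ i, μ i) / Fintype.card ι ∈ hypocycloidRegion (Fintype.card ι) := by
  have hcard : (Fintype.card ι : ℂ) ≠ 0 := by exact_mod_cast Fintype.card_ne_zero
  unfold hypocycloidRegion
  split_ifs with h1
  · obtain ⟨i₀, hi₀⟩ := Fintype.card_eq_one_iff.1 h1
    have huniv : (Finset.univ : Finset ι) = {i₀} := by ext i; simp [hi₀ i]
    have := hμ.2
    rw [huniv, Finset.prod_singleton] at this
    rw [huniv, Finset.sum_singleton, this, h1]
    simp
  · by_cases hz0 : ∑ i, μ i = 0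
    · rw [hz0, zero_div]
      exact Set.mem_iUnion.2 ⟨0, left_mem_segment ℝ _ _⟩
    have hK : IsCompact ((fun μ : ι → ℂ => ∑ i, μ i) '' unitConfigurations ι) :=
      (isCompact_unitConfigurations ι).image (by fun_prop)
    obtain ⟨s, hs, ⟨ν, hν, hνs⟩, hint⟩ := exists_last_point_on_ray hK ⟨μ, hμ, rfl⟩ hz0
    rw [← hνs] at hint
    obtain ⟨i₀, a, ha, h⟩ := exists_forall_ne_eq_of_not_mem_nhds hν hint
    obtain ⟨θ, hθ⟩ := exists_sum_eq_hypocycloidPoint hν ha h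
    have hs0 : (s : ℂ) ≠ 0 := by exact_mod_cast (zero_lt_one.trans_le hs).ne'
    -- The last point is s times the given sum, with s ≥ 1, so the given average is s⁻¹ times a
    -- hypocycloid point.
    refine Set.mem_iUnion.2 ⟨θ, 1 - s⁻¹, s⁻¹, by simpa using inv_le_one_of_one_le₀ hs,
      by positivity, by ring, ?_⟩
    change ∑ i, ν i = s * ∑ i, μ i at hνs
    rw [hνs] at hθ
    rw [smul_zero, zero_add, Complex.real_smul, Complex.ofReal_inv]
    field_simp
    linear_combination -hθ

/-! ### Fourier analysis on a finite abelian group -/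

section Fourier

variable {G : Type*} [AddCommGroup G] [Fintype G] [DecidableEq G]

/-- The squared modulus of û is the transform of the autocorrelation of `u`, which is the delta at
0. -/
theorem norm_sum_mul_addChar_eq_one {u : G → ℂ}
    (hu : ∀ l, ∑ m, u (m - l) * conj (u m) = if l = 0 then 1 else 0) (ψ : AddChar G ℂ) :
    ‖∑ g, u g * ψ g‖ = 1 := by
  have key : (∑ g, u g * ψ g) * conj (∑ g, u g * ψ g) = 1 := by
    calc (∑ g, u g * ψ g) * conj (∑ g, u g * ψ g)
        = ∑ h, ∑ g, u g * conj (u h) * ψ (g - h) := by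
          rw [map_sum, Finset.mul_sum]
          refine Finset.sum_congr rfl fun h _ => ?_
          rw [Finset.sum_mul]
          refine Finset.sum_congr rfl fun g _ => ?_
          rw [map_mul, ← AddChar.map_neg_eq_conj, sub_eq_add_neg, AddChar.map_add_eq_mul]
          ring
      _ = ∑ h, ∑ l, u (h - l) * conj (u h) * ψ (-l) := by
          refine Finset.sum_congr rfl fun h _ => ?_
          rw [← Equiv.sum_comp (Equiv.subLeft h)]
          refine Finset.sum_congr rfl fun l _ => ?_
          simp
      _ = ∑ l, (∑ h, u (h - l) * conj (u h)) * ψ (-l) := by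
          rw [Finset.sum_comm]
          simp only [Finset.sum_mul]
      _ = 1 := by simp [hu]
  rw [Complex.mul_conj, Complex.normSq_eq_norm_sq] at key
  have h2 : ‖∑ g, u g * ψ g‖ ^ 2 = 1 := by exact_mod_cast key
  exact (pow_eq_one_iff_of_nonneg (norm_nonneg _) two_ne_zero).1 h2

/-- On expanding, orthogonality in ψ kills every term u(g)·conj u(h) with g ≠ h. -/
theorem sum_addChar_autocorrelation (u : G → ℂ) (χ : AddChar G ℂ) :
    ∑ ψ : AddChar G ℂ, (∑ g, u g * (ψ * χ) g) * conj (∑ g, u g * ψ g) =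
      Fintype.card G * ∑ g, (‖u g‖ ^ 2 : ℝ) * χ g := by
  calc ∑ ψ : AddChar G ℂ, (∑ g, u g * (ψ * χ) g) * conj (∑ g, u g * ψ g)
      = ∑ ψ : AddChar G ℂ, ∑ h, ∑ g, u g * conj (u h) * χ g * ψ (g - h) := by
        refine Finset.sum_congr rfl fun ψ _ => ?_
        rw [map_sum, Finset.mul_sum]
        refine Finset.sum_congr rfl fun h _ => ?_
        rw [Finset.sum_mul]
        refine Finset.sum_congr rfl fun g _ => ?_
        rw [map_mul, ← AddChar.map_neg_eq_conj, sub_eq_add_neg, AddChar.map_add_eq_mul,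
          AddChar.mul_apply]
        ring
    _ = ∑ h, ∑ g, u g * conj (u h) * χ g * ∑ ψ : AddChar G ℂ, ψ (g - h) := by
        rw [Finset.sum_comm]
        refine Finset.sum_congr rfl fun h _ => ?_
        rw [Finset.sum_comm]
        simp only [Finset.mul_sum]
    _ = ∑ h, u h * conj (u h) * χ h * Fintype.card G := by
        refine Finset.sum_congr rfl fun h _ => ?_
        rw [Finset.sum_eq_single h]
        · simp
        · intro g _ hg
          simp [AddChar.sum_apply_eq_ite, sub_eq_zero, hg]
        · simp
    _ = _ := by
        rw [Finset.mul_sum]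
        refine Finset.sum_congr rfl fun h _ => ?_
        rw [Complex.mul_conj, Complex.normSq_eq_norm_sq]
        ring

/-- Fourier inversion: a function with zero transform is zero. -/
theorem exists_sum_addChar_mul_ne_zero {v : G → ℂ} (hv : v ≠ 0) :
    ∃ ψ : AddChar G ℂ, ∑ i, ψ i * v i ≠ 0 := by
  by_contra! h
  apply hv
  funext k
  have h0 : ∑ ψ : AddChar G ℂ, ψ (-k) * ∑ i, ψ i * v i = 0 := by simp [h]
  have h1 : ∑ ψ : AddChar G ℂ, ψ (-k) * ∑ i, ψ i * v i =
      ∑ i, (∑ ψ : AddChar G ℂ, ψ (i - k)) * v i := by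
    simp only [Finset.mul_sum, Finset.sum_mul]
    rw [Finset.sum_comm]
    refine Finset.sum_congr rfl fun i _ => Finset.sum_congr rfl fun ψ _ => ?_
    rw [sub_eq_add_neg, AddChar.map_add_eq_mul]
    ring
  rw [h1, Finset.sum_eq_single k] at h0
  · simpa using h0
  · intro i _ hi
    simp [AddChar.sum_apply_eq_ite, sub_eq_zero, hi]
  · simp

/-- The eigenvalues of convolution by `b` are the values of the Fourier transform of `b`. -/
theorem exists_addChar_of_convolution_eigenvector {b v : G → ℂ} {z : ℂ} (hv : v ≠ 0)
    (h : ∀ i, ∑ j, b (j - i) * v j = z * v i) :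
    ∃ χ : AddChar G ℂ, z = ∑ g, b g * χ g := by
  obtain ⟨ψ, hψ⟩ := exists_sum_addChar_mul_ne_zero hv
  -- Pair the eigenvector equation with ψ and put i = j - g: the factor ψ(-g) makes the eigenvalue
  -- the transform of `b` at ψ⁻¹.
  refine ⟨ψ⁻¹, mul_right_cancel₀ hψ ?_⟩
  calc z * ∑ i, ψ i * v i = ∑ i, ψ i * ∑ j, b (j - i) * v j := by
        rw [Finset.mul_sum]
        refine Finset.sum_congr rfl fun i _ => ?_
        rw [h]
        ring
    _ = ∑ j, ∑ i, ψ i * (b (j - i) * v j) := by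
        simp only [Finset.mul_sum]
        rw [Finset.sum_comm]
    _ = ∑ j, ∑ g, b g * ψ⁻¹ g * (ψ j * v j) := by
        refine Finset.sum_congr rfl fun j _ => ?_
        rw [← Equiv.sum_comp (Equiv.subLeft j)]
        refine Finset.sum_congr rfl fun g _ => ?_
        simp only [Equiv.subLeft_apply, sub_sub_cancel, AddChar.inv_apply]
        rw [sub_eq_add_neg, AddChar.map_add_eq_mul]
        ring
    _ = _ := by
        rw [Finset.mul_sum]
        simp only [Finset.sum_mul]

theorem fourier_norm_sq_mem_hypocycloidRegion {u : G → ℂ}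
    (hu : ∀ l, ∑ m, u (m - l) * conj (u m) = if l = 0 then 1 else 0) (χ : AddChar G ℂ) :
    ∑ g, (‖u g‖ ^ 2 : ℝ) * χ g ∈ hypocycloidRegion (Fintype.card G) := by
  have hnorm := norm_sum_mul_addChar_eq_one hu
  have hμ : (fun ψ : AddChar G ℂ => (∑ g, u g * (ψ * χ) g) * conj (∑ g, u g * ψ g)) ∈
      unitConfigurations (AddChar G ℂ) := by
    refine ⟨fun ψ => ?_, ?_⟩
    · rw [norm_mul, RCLike.norm_conj, hnorm, hnorm, mul_one]
    · have hshift : ∏ ψ : AddChar G ℂ, ∑ g, u g * (ψ * χ) g = ∏ ψ : AddChar G ℂ, ∑ g, u g * ψ g :=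
        Equiv.prod_comp (Equiv.mulRight χ) fun ψ : AddChar G ℂ => ∑ g, u g * ψ g
      rw [Finset.prod_mul_distrib, hshift, ← Finset.prod_mul_distrib]
      refine Finset.prod_eq_one fun ψ _ => ?_
      rw [Complex.mul_conj, Complex.normSq_eq_norm_sq, hnorm]
      simp
  have := sum_div_card_mem_hypocycloidRegion hμ
  rwa [sum_addChar_autocorrelation, AddChar.card_eq,
    mul_div_cancel_left₀ _ (by exact_mod_cast Fintype.card_ne_zero)] at this

end Fourier

/-! ### Eigenvalues of doubly circulant matrices -/

theorem IsCirculantMatrix.apply_eq {d : ℕ} [NeZero d] {R : Type*} {B : Matrix (Fin d) (Fin d) R}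
    (hB : IsCirculantMatrix B) (i j : Fin d) : B i j = B 0 (j - i) := by
  simpa using hB 0 j i

theorem mainTheorem4 (d : ℕ) (hd : 1 ≤ d) (B : Matrix (Fin d) (Fin d) ℝ)
    (hB : IsDoublyCirculantUnistochastic B) (z : ℂ)
    (hz : Module.End.HasEigenvalue (Matrix.toLin' (B.map Complex.ofReal)) z) :
    z ∈ hypocycloidRegion d := by
  have : NeZero d := ⟨by omega⟩
  obtain ⟨hcirc, -, U, hU, hUcirc, hBU⟩ := hB
  obtain ⟨v, hv⟩ := hz.exists_hasEigenvector
  -- Row `l` of `U` is row 0 shifted by `l`, so orthonormality of rows `l` and 0 is the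
  -- autocorrelation condition.
  have hu : ∀ l, ∑ m, U 0 (m - l) * conj (U 0 m) = if l = 0 then 1 else 0 := fun l => by
    have h := congrFun₂ (Matrix.mem_unitaryGroup_iff.1 hU) l 0
    rw [Matrix.one_apply, Matrix.mul_apply] at h
    simpa only [Matrix.star_apply, hUcirc.apply_eq l, starRingEnd_apply] using h
  obtain ⟨χ, rfl⟩ := exists_addChar_of_convolution_eigenvector
      (b := fun g => ((‖U 0 g‖ ^ 2 : ℝ) : ℂ)) hv.2 fun i => by
    have h := congrFun hv.apply_eq_smul i
    rw [Matrix.toLin'_apply, Matrix.mulVec, dotProduct] at h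
    simpa only [Matrix.map_apply, hcirc.apply_eq i, hBU, Pi.smul_apply, smul_eq_mul] using h
  simpa only [Fintype.card_fin] using fourier_norm_sq_mem_hypocycloidRegion hu χ
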